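/- Let $(\Omega,\mathcal F)$ be a measurable space, $T:\Omega\to\Omega$ a measurable map, $\mathcal I=\{A\in\mathcal F: T^{-1}A=A\}$. A capacity is a map $\mu:\mathcal F\to[0,1]$ with $\mu(\emptyset)=0$, $\mu(\Omega)=1$ and $\mu(A)\le\mu(B)$ whenever $A\subset B$; its core is the set $\operatorname{core}(\mu)$ of all finitely additive capacities $P$ with $P(A)\le\mu(A)$ for all $A\in\mathcal F$. A probability is a $\sigma$-additive capacity. Write $\mathcal M(T)$ for the set of $T$-invariant probabilities and $\mathcal M^e(T)$ for the set of ergodic ones (those $Q\in\mathcal M(T)$ with $Q(A)\in\{0,1\}$ for all $A\in\mathcal I$). A capacity $V$ is an upper probability if there is a set $\Lambda$ of probabilities, compact for the topology of setwise convergence on $\mathcal F$, such that $V(A)=\max_{P\in\Lambda}P(A)$ for all $A\in\mathcal F$. The Choquet integral of a bounded measurable $f:\Omega\to\mathbb R$ is $$\int f\,dV=\int_0^\infty V(\{f\ge t\})\,dt+\int_{-\infty}^0\bigl(V(\{f\ge t\})-1\bigr)\,dt .$$ Let $V$ be a $T$-invariant upper probability, i.e. an upper probability with $V(T^{-1}A)=V(A)$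 for all $A\in\mathcal F$. It is called ergodic if for every $A\in\mathcal I$: $V(A)\in\{0,1\}$, and $V(A)=0$ or $V(\Omega\setminus A)=0$. **Theorem.** The following four statements are equivalent: (i) $V$ is ergodic; (ii) there exists $Q\in\operatorname{core}(V)\cap\mathcal M^e(T)$ such that $V(A)=Q(A)$ for all $A\in\mathcal I$, and $$\lim_{n\to\infty}\int\frac1n\sum_{i=0}^{n-1}f\cdot(g\circ T^i)\,dV=\Bigl(\int f\,dV\Bigr)\Bigl(\int g\,dQ\Bigr)$$ for all bounded $\mathcal F$-measurable $f,g:\Omega\to\mathbb R$ with $g\ge0$; (iii) there exists $Q\in\operatorname{core}(V)\cap\mathcal M(T)$ such that $$\lim_{n\to\infty}\int\frac1n\sum_{i=0}^{n-1}1_B\cdot(1_C\circ T^i)\,dV=V(B)\,Q(C)\quad\text{for all }B,C\in\mathcal F;$$ (iv) there exists a probability $Q$ on $\mathcal F$ such that $V(A)=0$ for every $A\in\mathcal I$ with $Q(A)=0$, and $$\liminf_{n\to\infty}\int\frac1n\sum_{i=0}^{n-1}1_B\cdot(1_C\circ T^i)\,dV\ge V(B)\,Q(C)\quad\text{for all }B,C\in\mathcal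 F.$$ -/

import Mathlib

open MeasureTheory Filter Topology

noncomputable section

namespace UpperProb

variable {Ω : Type*} [MeasurableSpace Ω]

/-! Set functions on the σ-algebra of `Ω` are represented by functions `Set Ω → ℝ`; only their
values on measurable sets are ever used, and their values on other sets are irrelevant. -/

/-- A capacity: a monotone, normalized set function on the measurable sets
(monotonicity forces its values into `[0, 1]`). -/
structure IsCapacity (μ : Set Ω → ℝ) : Prop where
  empty : μ ∅ = 0
  univ : μ Set.univ = 1
  mono : ∀ A B : Set Ω, MeasurableSet A → MeasurableSet B → A ⊆ B → μ A ≤ μ B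

/-- Finite additivity on the measurable sets. -/
def IsAdditive (μ : Set Ω → ℝ) : Prop :=
  ∀ A B : Set Ω, MeasurableSet A → MeasurableSet B → Disjoint A B → μ (A ∪ B) = μ A + μ B

/-- The core of a set function: the (finitely) additive capacities dominated by it on
measurable sets. -/
def core (μ : Set Ω → ℝ) : Set (Set Ω → ℝ) :=
  {p | IsCapacity p ∧ IsAdditive p ∧ ∀ A : Set Ω, MeasurableSet A → p A ≤ μ A}

/-- The weak* topology on the (σ-additive) probabilities on `Ω`: the topology of setwise
convergence, i.e. of convergence of `P A` for every measurable set `A`. -/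
abbrev setwiseTopology (Ω : Type*) [MeasurableSpace Ω] : TopologicalSpace (ProbabilityMeasure Ω) :=
  TopologicalSpace.induced
    (fun (P : ProbabilityMeasure Ω) (A : {A : Set Ω // MeasurableSet A}) =>
      (P : Measure Ω).real A.1)
    inferInstance

/-- An upper probability: a capacity that is the (attained) maximum, on each measurable set, of a
weak*-compact set of probabilities. -/
def IsUpperProbability (V : Set Ω → ℝ) : Prop :=
  IsCapacity V ∧ ∃ Λ : Set (ProbabilityMeasure Ω), @IsCompact _ (setwiseTopology Ω) Λ ∧
    ∀ A : Set Ω, MeasurableSet A →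
      IsGreatest ((fun P : ProbabilityMeasure Ω => (P : Measure Ω).real A) '' Λ) (V A)

/-- `T`-invariance of a set function. -/
def IsInvariant (T : Ω → Ω) (μ : Set Ω → ℝ) : Prop :=
  ∀ A : Set Ω, MeasurableSet A → μ (T ⁻¹' A) = μ A

/-- Ergodicity of a capacity (to be used for invariant capacities), tested on the σ-algebra
of measurable sets `A` with `T ⁻¹' A = A`. -/
def IsErgodic (T : Ω → Ω) (μ : Set Ω → ℝ) : Prop :=
  ∀ A : Set Ω, MeasurableSet A → T ⁻¹' A = A →
    (μ A = 0 ∨ μ A = 1) ∧ (μ A = 0 ∨ μ Aᶜ = 0)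

/-- The Choquet integral with respect to a set function. -/
def choquet (μ : Set Ω → ℝ) (f : Ω → ℝ) : ℝ :=
  (∫ t in Set.Ioi (0 : ℝ), μ {ω | t ≤ f ω}) + ∫ t in Set.Iio (0 : ℝ), (μ {ω | t ≤ f ω} - 1)

/-- Bounded measurable real functions on `Ω`. -/
def IsBoundedMeasurable (f : Ω → ℝ) : Prop :=
  Measurable f ∧ ∃ M : ℝ, ∀ ω, |f ω| ≤ M

/-- The function `(1/n) ∑_{i=0}^{n-1} f · (g ∘ T^i)`. -/
def correlationAverage (T : Ω → Ω) (f g : Ω → ℝ) (n : ℕ) : Ω → ℝ :=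
  fun ω => (1 / (n : ℝ)) * ∑ i ∈ Finset.range n, f ω * g (T^[i] ω)

/-- The indicator function of a set, with real values. -/
def ind (A : Set Ω) : Ω → ℝ := A.indicator (fun _ => (1 : ℝ))

end UpperProb

end

/-! The only hard implication is from ergodicity of V to convergence. Averaging a probability
dominated by V along T and taking an ultrafilter limit gives an invariant finitely additive element
of the core. It is σ-additive because V decreases to 0 along sets decreasing to ∅
(`tendsto_iInter`). If V is ergodic, domination forces the resulting Q to be ergodic and to agree
with V on invariant sets.

Birkhoff's theorem for Q then gives convergence of the averages of g to ∫ g dQ on a full-measure set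
E. It is essential that E be strictly invariant (`exists_invariant_tendsto_birkhoffAverage`): Q-null
sets need not be V-null in general, but invariant ones are. Hence f times the averages converges off
a V-null set, and bounded convergence (`tendsto_choquet`) with positive homogeneity of the Choquet
integral gives the limit.

The way back tests indicators of an invariant A. The pair (A, A) has constant correlations, which
shows that Q-null invariant sets are V-null. The pair (A, Aᶜ) has zero correlations, which gives
V(A) Q(Aᶜ) = 0 and hence the dichotomy for V. -/

noncomputable section

namespace UpperProb

/-! ### Maximal inequality and Birkhoff's theorem on an invariant set -/

section Birkhoff

variable {Ω : Type*}

theorem measurable_birkhoffSum [MeasurableSpace Ω]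
    {T : Ω → Ω} (hT : Measurable T) {f : Ω → ℝ} (hf : Measurable f)
    (n : ℕ) : Measurable (birkhoffSum T f n) :=
  Finset.measurable_fun_sum _ fun k _ => hf.comp (hT.iterate k)

theorem integrable_birkhoffSum [MeasurableSpace Ω]
    {T : Ω → Ω} {μ : Measure Ω} (hT : MeasurePreserving T μ μ)
    {f : Ω → ℝ} (hf : Integrable f μ) (n : ℕ) : Integrable (birkhoffSum T f n) μ :=
  integrable_finsetSum _ fun k _ => (hT.iterate k).integrable_comp_of_integrable hf

/-- The running maximum of the Birkhoff sums of `f` up to time `n`. -/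
def maxBirkhoffSum (T : Ω → Ω) (f : Ω → ℝ) (n : ℕ) (x : Ω) : ℝ :=
  partialSups (fun k => birkhoffSum T f k x) n

theorem maxBirkhoffSum_zero (T : Ω → Ω) (f : Ω → ℝ) : maxBirkhoffSum T f 0 = fun _ => 0 := by
  ext x; simp [maxBirkhoffSum]

theorem maxBirkhoffSum_succ (T : Ω → Ω) (f : Ω → ℝ) (n : ℕ) :
    maxBirkhoffSum T f (n + 1) = maxBirkhoffSum T f n ⊔ birkhoffSum T f (n + 1) := by
  ext x; simp [maxBirkhoffSum]

theorem birkhoffSum_le_maxBirkhoffSum (T : Ω → Ω) (f : Ω → ℝ) {k n : ℕ} (h : k ≤ n) (x : Ω) :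
    birkhoffSum T f k x ≤ maxBirkhoffSum T f n x :=
  le_partialSups_of_le (fun k => birkhoffSum T f k x) h

theorem maxBirkhoffSum_nonneg (T : Ω → Ω) (f : Ω → ℝ) (n : ℕ) (x : Ω) :
    0 ≤ maxBirkhoffSum T f n x := by
  simpa using birkhoffSum_le_maxBirkhoffSum T f (Nat.zero_le n) x

theorem maxBirkhoffSum_mono (T : Ω → Ω) (f : Ω → ℝ) (x : Ω) :
    Monotone fun n => maxBirkhoffSum T f n x :=
  (partialSups fun k => birkhoffSum T f k x).monotone

theorem measurable_maxBirkhoffSum [MeasurableSpace Ω]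
    {T : Ω → Ω} (hT : Measurable T) {f : Ω → ℝ} (hf : Measurable f)
    (n : ℕ) : Measurable (maxBirkhoffSum T f n) := by
  induction n with
  | zero => rw [maxBirkhoffSum_zero]; exact measurable_const
  | succ n ih => rw [maxBirkhoffSum_succ]; exact ih.sup (measurable_birkhoffSum hT hf _)

theorem integrable_maxBirkhoffSum [MeasurableSpace Ω]
    {T : Ω → Ω} {μ : Measure Ω} (hT : MeasurePreserving T μ μ)
    {f : Ω → ℝ} (hf : Integrable f μ) (n : ℕ) : Integrable (maxBirkhoffSum T f n) μ := by
  induction n with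
  | zero => rw [maxBirkhoffSum_zero]; exact integrable_zero _ _ _
  | succ n ih => rw [maxBirkhoffSum_succ]; exact ih.sup (integrable_birkhoffSum hT hf _)

/-- A nonempty Birkhoff sum at x is f x plus a shorter sum at T x. Where the maximum is positive it
is therefore at most f x plus the maximum at T x. Integrating this bound makes the left side cancel.
-/
theorem maxBirkhoffSum_sub_le (T : Ω → Ω) (f : Ω → ℝ) (n : ℕ) (x : Ω) :
    maxBirkhoffSum T f n x - maxBirkhoffSum T f n (T x) ≤
      {y | 0 < maxBirkhoffSum T f n y}.indicator f x := by
  have hle : maxBirkhoffSum T f n x ≤ max 0 (f x + maxBirkhoffSum T f n (T x)) := by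
    refine partialSups_le _ _ _ fun k hk => ?_
    rcases k with _ | k
    · simp
    · rw [birkhoffSum_succ']
      exact le_max_of_le_right
        (add_le_add_right (birkhoffSum_le_maxBirkhoffSum T f (by omega) _) _)
  by_cases hx : 0 < maxBirkhoffSum T f n x
  · rw [Set.indicator_of_mem (by exact hx)]
    rcases le_max_iff.1 hle with h | h <;> linarith
  · rw [Set.indicator_of_notMem (by exact hx)]
    linarith [maxBirkhoffSum_nonneg T f n (T x)]

/-- The maximal ergodic theorem. -/
theorem setIntegral_maxBirkhoffSum_pos_nonneg [MeasurableSpace Ω] {T : Ω → Ω} {μ : Measure Ω}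
    (hT : MeasurePreserving T μ μ) {f : Ω → ℝ} (hfm : Measurable f) (hf : Integrable f μ)
    (n : ℕ) : 0 ≤ ∫ x in {y | 0 < maxBirkhoffSum T f n y}, f x ∂μ := by
  have hm : MeasurableSet {y | 0 < maxBirkhoffSum T f n y} :=
    measurableSet_lt measurable_const (measurable_maxBirkhoffSum hT.measurable hfm n)
  have hi := integrable_maxBirkhoffSum hT hf n
  have hiT : Integrable (fun x => maxBirkhoffSum T f n (T x)) μ :=
    hT.integrable_comp_of_integrable hi
  have heq : ∫ x, maxBirkhoffSum T f n (T x) ∂μ = ∫ x, maxBirkhoffSum T f n x ∂μ := by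
    rw [← integral_map hT.measurable.aemeasurable (by rw [hT.map_eq]; exact hi.1), hT.map_eq]
  calc (0 : ℝ) = ∫ x, (maxBirkhoffSum T f n x - maxBirkhoffSum T f n (T x)) ∂μ := by
        rw [integral_sub hi hiT, heq, sub_self]
    _ ≤ ∫ x, {y | 0 < maxBirkhoffSum T f n y}.indicator f x ∂μ :=
        integral_mono (hi.sub hiT) (hf.indicator hm) (maxBirkhoffSum_sub_le T f n)
    _ = _ := integral_indicator hm

/-- The set of points at which the Birkhoff sums of `f` are bounded above. -/
def birkhoffBoundedSet (T : Ω → Ω) (f : Ω → ℝ) : Set Ω :=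
  {x | ∃ K : ℕ, ∀ n, birkhoffSum T f n x ≤ K}

theorem measurableSet_birkhoffBoundedSet [MeasurableSpace Ω]
    {T : Ω → Ω} (hT : Measurable T) {f : Ω → ℝ}
    (hf : Measurable f) : MeasurableSet (birkhoffBoundedSet T f) := by
  have : birkhoffBoundedSet T f = ⋃ K : ℕ, ⋂ n, {x | birkhoffSum T f n x ≤ K} := by
    ext x; simp [birkhoffBoundedSet]
  rw [this]
  exact .iUnion fun K => .iInter fun n =>
    measurableSet_le (measurable_birkhoffSum hT hf n) measurable_const

/-- Passing between x and T x changes the sums only by f x and an index shift, so invariance is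
exact rather than almost everywhere. -/
theorem preimage_birkhoffBoundedSet (T : Ω → Ω) (f : Ω → ℝ) :
    T ⁻¹' birkhoffBoundedSet T f = birkhoffBoundedSet T f := by
  ext x
  constructor
  · rintro ⟨K, hK⟩
    obtain ⟨L, hL⟩ := exists_nat_ge (max 0 (f x + K))
    refine ⟨L, fun n => le_trans ?_ hL⟩
    rcases n with _ | n
    · simp
    · rw [birkhoffSum_succ']
      exact le_max_of_le_right (add_le_add_right (hK n) _)
  · rintro ⟨K, hK⟩
    obtain ⟨L, hL⟩ := exists_nat_ge (K - f x)
    refine ⟨L, fun n => ?_⟩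
    have := hK (n + 1)
    rw [birkhoffSum_succ'] at this
    linarith

/-- By ergodicity the bounded set is null or conull. Were it null, some sum would be positive almost
everywhere, and the maximal inequality would pass to the limit as ∫ f ≥ 0. -/
theorem measure_compl_birkhoffBoundedSet [MeasurableSpace Ω] {T : Ω → Ω} {μ : Measure Ω}
    (hT : Ergodic T μ) {f : Ω → ℝ} (hfm : Measurable f)
    (hf : Integrable f μ) (hneg : ∫ x, f x ∂μ < 0) : μ (birkhoffBoundedSet T f)ᶜ = 0 := by
  refine (hT.measure_self_or_compl_eq_zero
    (measurableSet_birkhoffBoundedSet hT.measurable hfm)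
    (preimage_birkhoffBoundedSet T f)).resolve_left fun h0 => ?_
  have hlim : Tendsto (fun n => ∫ x in {y | 0 < maxBirkhoffSum T f n y}, f x ∂μ) atTop
      (𝓝 (∫ x in ⋃ n, {y | 0 < maxBirkhoffSum T f n y}, f x ∂μ)) :=
    tendsto_setIntegral_of_monotone
      (fun n => measurableSet_lt measurable_const
        (measurable_maxBirkhoffSum hT.measurable hfm n))
      (fun m n hmn x hx => lt_of_lt_of_le hx (maxBirkhoffSum_mono T f x hmn)) hf.integrableOn
  have huniv : (⋃ n, {y | 0 < maxBirkhoffSum T f n y}) =ᵐ[μ] Set.univ := by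
    rw [ae_eq_univ]
    refine measure_mono_null (fun x hx => ?_) h0
    simp only [Set.mem_compl_iff, Set.mem_iUnion, Set.mem_ofPred_eq, not_exists, not_lt] at hx
    exact ⟨0, fun n => by simpa using (birkhoffSum_le_maxBirkhoffSum T f le_rfl x).trans (hx n)⟩
  rw [setIntegral_congr_set huniv, setIntegral_univ] at hlim
  exact absurd (ge_of_tendsto' hlim
    (setIntegral_maxBirkhoffSum_pos_nonneg hT.toMeasurePreserving hfm hf)) (not_le.2 hneg)

theorem birkhoffSum_sub_const (T : Ω → Ω) (g : Ω → ℝ) (a : ℝ) (n : ℕ) (x : Ω) :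
    birkhoffSum T (fun y => g y - a) n x = birkhoffSum T g n x - n * a := by
  simp [birkhoffSum, Finset.sum_sub_distrib]

theorem birkhoffSum_const_sub (T : Ω → Ω) (g : Ω → ℝ) (a : ℝ) (n : ℕ) (x : Ω) :
    birkhoffSum T (fun y => a - g y) n x = n * a - birkhoffSum T g n x := by
  simp [birkhoffSum, Finset.sum_sub_distrib]

/-- Birkhoff's pointwise ergodic theorem for ergodic probabilities, with a strictly invariant
set of full measure on which convergence holds. -/
theorem exists_invariant_tendsto_birkhoffAverage [MeasurableSpace Ω] {T : Ω → Ω} {μ : Measure Ω}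
    [IsProbabilityMeasure μ] (hT : Ergodic T μ) {g : Ω → ℝ} (hgm : Measurable g)
    (hg : Integrable g μ) :
    ∃ E : Set Ω, MeasurableSet E ∧ T ⁻¹' E = E ∧ μ Eᶜ = 0 ∧
      ∀ x ∈ E, Tendsto (fun n => birkhoffAverage ℝ T g n x) atTop (𝓝 (∫ y, g y ∂μ)) := by
  set c := ∫ y, g y ∂μ with hc
  let ε : ℕ → ℝ := fun k => 1 / ((k : ℝ) + 1)
  have hε : ∀ k, 0 < ε k := fun k => Nat.one_div_pos_of_nat
  -- Bounded sums of g - (c + ε) keep the limsup of the averages at most c + ε, and `L` does the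
  -- same for the liminf. The shift by ε makes the integral strictly negative.
  let U : ℕ → Set Ω := fun k => birkhoffBoundedSet T fun y => g y - (c + ε k)
  let L : ℕ → Set Ω := fun k => birkhoffBoundedSet T fun y => (c - ε k) - g y
  have hU : ∀ k, μ (U k)ᶜ = 0 := fun k => by
    refine measure_compl_birkhoffBoundedSet hT (hgm.sub measurable_const)
      (hg.sub (integrable_const _)) ?_
    rw [integral_sub hg (integrable_const _), ← hc]
    simp [hε k]
  have hL : ∀ k, μ (L k)ᶜ = 0 := fun k => by
    refine measure_compl_birkhoffBoundedSet hT (measurable_const.sub hgm)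
      ((integrable_const _).sub hg) ?_
    rw [integral_sub (integrable_const _) hg, ← hc]
    simp [hε k]
  refine ⟨⋂ k, U k ∩ L k, .iInter fun k =>
      (measurableSet_birkhoffBoundedSet hT.measurable (hgm.sub measurable_const)).inter
      (measurableSet_birkhoffBoundedSet hT.measurable (measurable_const.sub hgm)), ?_, ?_, ?_⟩
  · simp only [Set.preimage_iInter, Set.preimage_inter, U, L, preimage_birkhoffBoundedSet]
  · simp only [Set.compl_iInter, Set.compl_inter, measure_iUnion_null_iff, measure_union_null_iff]
    exact fun k => ⟨hU k, hL k⟩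
  · intro x hx
    rw [Metric.tendsto_atTop]
    intro δ hδ
    obtain ⟨k, hk⟩ := exists_nat_one_div_lt (half_pos hδ)
    obtain ⟨⟨K₁, h₁⟩, ⟨K₂, h₂⟩⟩ := Set.mem_iInter.1 hx k
    -- Half of δ absorbs the bounds K₁/n and K₂/n, the other half absorbs `ε k`.
    obtain ⟨N, hN⟩ := exists_nat_gt (max (K₁ : ℝ) K₂ / (δ / 2))
    refine ⟨N + 1, fun n hn => ?_⟩
    have hnpos : (0 : ℝ) < n := by exact_mod_cast (by omega : 0 < n)
    have hKn : max (K₁ : ℝ) K₂ < n * (δ / 2) := by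
      rw [div_lt_iff₀ (half_pos hδ)] at hN
      refine hN.trans_le (mul_le_mul_of_nonneg_right ?_ (half_pos hδ).le)
      exact_mod_cast (by omega : N ≤ n)
    have hb₁ := h₁ n
    have hb₂ := h₂ n
    rw [birkhoffSum_sub_const] at hb₁
    rw [birkhoffSum_const_sub] at hb₂
    have hK₁ := (le_max_left (K₁ : ℝ) K₂).trans_lt hKn
    have hK₂ := (le_max_right (K₁ : ℝ) K₂).trans_lt hKn
    have hεn : n * ε k < n * (δ / 2) := mul_lt_mul_of_pos_left hk hnpos
    rw [Real.dist_eq, birkhoffAverage, smul_eq_mul, abs_lt, inv_mul_eq_div]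
    constructor
    · rw [lt_sub_iff_add_lt, lt_div_iff₀ hnpos]; nlinarith
    · rw [sub_lt_iff_lt_add, div_lt_iff₀ hnpos]; nlinarith

end Birkhoff

/-! ### Continuity of upper probabilities and their cores -/

section Capacity

variable {Ω : Type*} [MeasurableSpace Ω] {V : Set Ω → ℝ}

theorem IsCapacity.nonneg (hV : IsCapacity V) {A : Set Ω} (hA : MeasurableSet A) : 0 ≤ V A :=
  hV.empty ▸ hV.mono ∅ A .empty hA A.empty_subset

theorem IsCapacity.le_one (hV : IsCapacity V) {A : Set Ω} (hA : MeasurableSet A) : V A ≤ 1 :=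
  hV.univ ▸ hV.mono A Set.univ hA .univ A.subset_univ

theorem isCapacity_real (P : ProbabilityMeasure Ω) : IsCapacity (P : Measure Ω).real where
  empty := measureReal_empty
  univ := probReal_univ
  mono _ _ _ _ h := measureReal_mono h

theorem isAdditive_real (P : ProbabilityMeasure Ω) : IsAdditive (P : Measure Ω).real :=
  fun _ _ _ hB h => measureReal_union h hB

theorem tendsto_setwise_iff {ι : Type*} {l : Filter ι} {p : ι → ProbabilityMeasure Ω}
    {P : ProbabilityMeasure Ω} :
    Tendsto p l (@nhds _ (setwiseTopology Ω) P) ↔ ∀ A : Set Ω, MeasurableSet A →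
      Tendsto (fun i => (p i : Measure Ω).real A) l (𝓝 ((P : Measure Ω).real A)) := by
  rw [nhds_induced, tendsto_comap_iff, tendsto_pi_nhds]
  exact ⟨fun h A hA => h ⟨A, hA⟩, fun h A => h A.1 A.2⟩

namespace IsUpperProbability

theorem union_le (hV : IsUpperProbability V) {A B : Set Ω} (hA : MeasurableSet A)
    (hB : MeasurableSet B) : V (A ∪ B) ≤ V A + V B := by
  obtain ⟨-, Λ, -, h⟩ := hV
  obtain ⟨P, hP, hPe⟩ := (h _ (hA.union hB)).1
  rw [← hPe]
  exact (measureReal_union_le A B).trans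
    (add_le_add ((h A hA).2 ⟨P, hP, rfl⟩) ((h B hB).2 ⟨P, hP, rfl⟩))

theorem le_add_of_subset_union (hV : IsUpperProbability V) {A B C : Set Ω} (hA : MeasurableSet A)
    (hB : MeasurableSet B) (hC : MeasurableSet C) (h : A ⊆ B ∪ C) : V A ≤ V B + V C :=
  (hV.1.mono _ _ hA (hB.union hC) h).trans (hV.union_le hB hC)

theorem exists_le (hV : IsUpperProbability V) : ∃ P : ProbabilityMeasure Ω,
    ∀ A, MeasurableSet A → (P : Measure Ω).real A ≤ V A := by
  obtain ⟨-, Λ, -, h⟩ := hV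
  obtain ⟨P, hP, -⟩ := (h _ .univ).1
  exact ⟨P, fun A hA => (h A hA).2 ⟨P, hP, rfl⟩⟩

/-- Upper probabilities are continuous from above. -/
theorem tendsto_iInter (hV : IsUpperProbability V) {s : ℕ → Set Ω} (hs : ∀ n, MeasurableSet (s n))
    (hanti : Antitone s) : Tendsto (fun n => V (s n)) atTop (𝓝 (V (⋂ n, s n))) := by
  have hVc := hV.1
  have hVanti : Antitone fun n => V (s n) := fun m n h => hVc.mono _ _ (hs n) (hs m) (hanti h)
  have hbdd : BddBelow (Set.range fun n => V (s n)) :=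
    ⟨0, Set.forall_mem_range.2 fun n => hVc.nonneg (hs n)⟩
  have hinf := tendsto_atTop_ciInf hVanti hbdd
  suffices (⨅ n, V (s n)) = V (⋂ n, s n) by rwa [← this]
  refine le_antisymm ?_ (le_ciInf fun n => hVc.mono _ _ (.iInter hs) (hs n)
    (Set.iInter_subset s n))
  obtain ⟨-, Λ, hΛ, h⟩ := hV
  -- Each `p n` is a maximizer for `s n`; compactness gives a limit P along an ultrafilter, so no
  -- sequential compactness is needed.
  choose p hp hpe using fun n => (h _ (hs n)).1
  obtain ⟨P, hPΛ, hP⟩ := (@isCompact_iff_ultrafilter_le_nhds _ (setwiseTopology Ω) Λ).1 hΛ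
    ((hyperfilter ℕ).map p) (by
      rw [le_principal_iff]; exact mem_map.2 (univ_mem' hp))
  have hPt := tendsto_setwise_iff.1 (show Tendsto p (hyperfilter ℕ) _ from hP)
  -- For n ≥ m, the mass that `p n` gives to `s m` is at least V (s n). The limit is taken in n with
  -- m fixed; σ-additivity of P then handles m.
  have hge : ∀ m, (⨅ n, V (s n)) ≤ (P : Measure Ω).real (s m) := fun m => by
    refine ge_of_tendsto (hPt _ (hs m)) (Nat.hyperfilter_le_atTop ?_)
    filter_upwards [eventually_ge_atTop m] with n hn
    exact (ciInf_le hbdd n).trans ((hpe n).ge.trans (measureReal_mono (hanti hn)))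
  have hlim : Tendsto (fun m => (P : Measure Ω).real (s m)) atTop
      (𝓝 ((P : Measure Ω).real (⋂ n, s n))) :=
    (ENNReal.tendsto_toReal (measure_ne_top _ _)).comp
      (tendsto_measure_iInter_atTop (fun n => (hs n).nullMeasurableSet) hanti
        ⟨0, measure_ne_top _ _⟩)
  exact (ge_of_tendsto' hlim hge).trans ((h _ (.iInter hs)).2 ⟨P, hPΛ, rfl⟩)

/-- Upper probabilities are continuous from below. -/
theorem tendsto_iUnion (hV : IsUpperProbability V) {s : ℕ → Set Ω} (hs : ∀ n, MeasurableSet (s n))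
    (hmono : Monotone s) : Tendsto (fun n => V (s n)) atTop (𝓝 (V (⋃ n, s n))) := by
  have hVc := hV.1
  have hle : ∀ n, V (s n) ≤ V (⋃ n, s n) := fun n =>
    hVc.mono _ _ (hs n) (.iUnion hs) (Set.subset_iUnion s n)
  obtain ⟨-, Λ, -, h⟩ := hV
  obtain ⟨P, hPΛ, hPe⟩ := (h _ (MeasurableSet.iUnion hs)).1
  have hlim : Tendsto (fun m => (P : Measure Ω).real (s m)) atTop
      (𝓝 ((P : Measure Ω).real (⋃ n, s n))) :=
    (ENNReal.tendsto_toReal (measure_ne_top _ _)).comp (tendsto_measure_iUnion_atTop hmono)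
  rw [← hPe] at hle ⊢
  exact tendsto_of_tendsto_of_tendsto_of_le_of_le hlim tendsto_const_nhds
    (fun n => (h _ (hs n)).2 ⟨P, hPΛ, rfl⟩) hle

/-- A finitely additive capacity dominated by an upper probability is a probability. -/
theorem exists_probabilityMeasure_of_mem_core (hV : IsUpperProbability V) {q : Set Ω → ℝ}
    (hq : q ∈ core V) :
    ∃ Q : ProbabilityMeasure Ω, ∀ A, MeasurableSet A → (Q : Measure Ω).real A = q A := by
  obtain ⟨hqc, hqa, hqV⟩ := hq
  have hsum : ∀ f : ℕ → Set Ω, (∀ i, MeasurableSet (f i)) → Pairwise (Function.onFun Disjoint f) →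
      HasSum (fun i => q (f i)) (q (⋃ i, f i)) := by
    intro f hf hd
    rw [hasSum_iff_tendsto_nat_of_nonneg fun i => hqc.nonneg (hf i)]
    let R : ℕ → Set Ω := fun n => ⋃ i, f (n + i)
    have hR : ∀ n, MeasurableSet (R n) := fun n => .iUnion fun i => hf _
    have hRanti : Antitone R := fun m n hmn => Set.iUnion_subset fun i => by
      obtain ⟨k, rfl⟩ := Nat.exists_eq_add_of_le hmn
      rw [add_assoc]
      exact Set.subset_iUnion (fun i => f (m + i)) (k + i)
    have hRempty : ⋂ n, R n = ∅ := by
      refine Set.eq_empty_of_forall_notMem fun x hx => ?_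
      obtain ⟨i, hi⟩ := Set.mem_iUnion.1 (Set.mem_iInter.1 hx 0)
      obtain ⟨j, hj⟩ := Set.mem_iUnion.1 (Set.mem_iInter.1 hx (i + 1))
      exact Set.disjoint_left.1 (hd (by omega : 0 + i ≠ i + 1 + j)) hi hj
    have hdecomp : ∀ n, ∑ i ∈ Finset.range n, q (f i) = q (⋃ i, f i) - q (R n) := by
      intro n
      induction n with
      | zero => simp [R]
      | succ n ih =>
        have hRn : R n = f n ∪ R (n + 1) := by
          ext x
          simp only [R, Set.mem_iUnion, Set.mem_union]
          constructor
          · rintro ⟨_ | i, hi⟩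
            · exact .inl hi
            · exact .inr ⟨i, by rwa [add_right_comm, add_assoc]⟩
          · rintro (hx | ⟨i, hi⟩)
            · exact ⟨0, hx⟩
            · exact ⟨i + 1, by rwa [add_right_comm, add_assoc] at hi⟩
        have hdis : Disjoint (f n) (R (n + 1)) :=
          Set.disjoint_iUnion_right.2 fun i => hd (by omega)
        rw [Finset.sum_range_succ, ih, hRn, hqa _ _ (hf n) (hR _) hdis]
        ring
    -- Domination by V and its continuity at ∅ kill the tails; this is where σ-additivity comes
    -- from.
    have hR0 : Tendsto (fun n => q (R n)) atTop (𝓝 0) := by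
      have := hV.tendsto_iInter hR hRanti
      rw [hRempty, hV.1.empty] at this
      exact squeeze_zero (fun n => hqc.nonneg (hR n)) (fun n => hqV _ (hR n)) this
    simp_rw [hdecomp]
    simpa using tendsto_const_nhds.sub hR0
  let m : Measure Ω := Measure.ofMeasurable (fun s _ => ENNReal.ofReal (q s))
    (by simp [hqc.empty]) (fun f hf hd => by
      rw [← (hsum f hf hd).tsum_eq, ENNReal.ofReal_tsum_of_nonneg
        (fun i => hqc.nonneg (hf i)) (hsum f hf hd).summable])
  have hm : ∀ A, MeasurableSet A → m A = ENNReal.ofReal (q A) := fun A hA =>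
    Measure.ofMeasurable_apply A hA
  refine ⟨⟨m, ⟨by rw [hm _ .univ, hqc.univ, ENNReal.ofReal_one]⟩⟩, fun A hA => ?_⟩
  rw [Measure.real, ProbabilityMeasure.coe_mk, hm A hA, ENNReal.toReal_ofReal (hqc.nonneg hA)]

/-- The core of an invariant upper probability contains an invariant probability. -/
theorem exists_invariant_mem_core (hV : IsUpperProbability V) {T : Ω → Ω} (hT : Measurable T)
    (hinv : IsInvariant T V) : ∃ Q : ProbabilityMeasure Ω, (Q : Measure Ω).real ∈ core V ∧
      MeasurePreserving T (Q : Measure Ω) (Q : Measure Ω) := by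
  obtain ⟨P, hP⟩ := hV.exists_le
  have hiter : ∀ i A, MeasurableSet A → V (T^[i] ⁻¹' A) = V A := by
    intro i A hA
    induction i with
    | zero => rfl
    | succ i ih =>
      rw [Function.iterate_succ, Set.preimage_comp, hinv _ (hT.iterate i hA), ih]
  let a : Set Ω → ℕ → ℝ := fun A i => (P : Measure Ω).real (T^[i] ⁻¹' A)
  let p : ℕ → Set Ω → ℝ := fun n A => ((n : ℝ) + 1)⁻¹ * ∑ i ∈ Finset.range (n + 1), a A i
  have ha : ∀ A i, a A i ∈ Set.Icc (0 : ℝ) 1 := fun A i =>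
    ⟨measureReal_nonneg, measureReal_le_one⟩
  have hpos : ∀ n : ℕ, (0 : ℝ) < (n : ℝ) + 1 := fun n => by positivity
  have hp_le : ∀ A (c : ℝ), (∀ i, a A i ≤ c) → ∀ n, p n A ≤ c := fun A c h n => by
    simp only [p]
    rw [inv_mul_le_iff₀ (hpos n)]
    simpa using Finset.sum_le_card_nsmul (Finset.range (n + 1)) (a A) c fun i _ => h i
  have hp_nonneg : ∀ A n, 0 ≤ p n A := fun A n =>
    mul_nonneg (inv_nonneg.2 (hpos n).le) (Finset.sum_nonneg fun i _ => (ha A i).1)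
  -- One ultrafilter serves all sets at once, so finite additivity and monotonicity pass to the
  -- limit.
  have hlim : ∀ A, ∃ x, Tendsto (fun n => p n A) (hyperfilter ℕ : Filter ℕ) (𝓝 x) := fun A => by
    obtain ⟨x, -, hx⟩ := isCompact_iff_ultrafilter_le_nhds.1 (isCompact_Icc (a := (0 : ℝ)) (b := 1))
      ((hyperfilter ℕ).map fun n => p n A) (by
        rw [le_principal_iff]
        exact mem_map.2 (univ_mem' fun n =>
          ⟨hp_nonneg A n, hp_le A 1 (fun i => (ha A i).2) n⟩))
    exact ⟨x, hx⟩
  choose q hq using hlim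
  have hqV : ∀ A, MeasurableSet A → q A ≤ V A := fun A hA =>
    le_of_tendsto' (hq A) (hp_le A _ fun i => (hP _ (hT.iterate i hA)).trans (hiter i A hA).le)
  have hqcore : q ∈ core V := by
    refine ⟨⟨?_, ?_, fun A B hA hB h => ?_⟩, fun A B hA hB h => ?_, hqV⟩
    · exact le_antisymm ((hqV ∅ .empty).trans hV.1.empty.le) (ge_of_tendsto' (hq _) (hp_nonneg ∅))
    · refine tendsto_nhds_unique (hq _) (tendsto_const_nhds.congr fun n => ?_)
      simp only [p, a, Set.preimage_univ, probReal_univ, Finset.sum_const, Finset.card_range,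
        nsmul_eq_mul, mul_one, Nat.cast_add, Nat.cast_one]
      rw [inv_mul_cancel₀ (hpos n).ne']
    · refine le_of_tendsto_of_tendsto' (hq A) (hq B) fun n => ?_
      exact mul_le_mul_of_nonneg_left (Finset.sum_le_sum fun i _ =>
        measureReal_mono (Set.preimage_mono h)) (inv_nonneg.2 (hpos n).le)
    · refine tendsto_nhds_unique (hq _) (((hq A).add (hq B)).congr fun n => ?_)
      simp only [p, a, ← mul_add, ← Finset.sum_add_distrib]
      congr 1
      refine Finset.sum_congr rfl fun i _ => ?_
      rw [Set.preimage_union, measureReal_union (h.preimage _) (hT.iterate i hB)]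
  have hqinv : ∀ A, q (T ⁻¹' A) = q A := fun A => by
    -- The shifted average differs from the original only in its two end terms, each in [0, 1].
    have hdiff : Tendsto (fun n => p n (T ⁻¹' A) - p n A) atTop (𝓝 0) := by
      have hbound : ∀ n, |p n (T ⁻¹' A) - p n A| ≤ 1 / ((n : ℝ) + 1) := fun n => by
        have hshift : ∀ i, a (T ⁻¹' A) i = a A (i + 1) := fun i => by
          simp only [a, ← Set.preimage_comp, ← Function.iterate_succ']
        have : p n (T ⁻¹' A) - p n A = ((n : ℝ) + 1)⁻¹ * (a A (n + 1) - a A 0) := by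
          simp only [p, hshift, ← mul_sub, ← Finset.sum_sub_distrib]
          rw [Finset.sum_range_sub]
        rw [this, abs_mul, abs_of_pos (inv_pos.2 (hpos n)), one_div]
        refine mul_le_of_le_one_right (inv_nonneg.2 (hpos n).le) (abs_le.2 ⟨?_, ?_⟩) <;>
          linarith [(ha A 0).1, (ha A 0).2, (ha A (n + 1)).1, (ha A (n + 1)).2]
      exact squeeze_zero_norm hbound tendsto_one_div_add_atTop_nhds_zero_nat
    have := tendsto_nhds_unique ((hq (T ⁻¹' A)).sub (hq A))
      (hdiff.mono_left Nat.hyperfilter_le_atTop)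
    linarith
  obtain ⟨Q, hQ⟩ := hV.exists_probabilityMeasure_of_mem_core hqcore
  refine ⟨Q, ⟨isCapacity_real Q, isAdditive_real Q, fun A hA => (hQ A hA).trans_le (hqV A hA)⟩,
    hT, Measure.ext fun A hA => ?_⟩
  rw [Measure.map_apply hT hA, ← measureReal_eq_measureReal_iff, hQ _ (hT hA), hQ A hA, hqinv]

end IsUpperProbability

end Capacity

/-! ### Homogeneity and bounded convergence for the Choquet integral -/

section Choquet

variable {Ω : Type*} [MeasurableSpace Ω] {V : Set Ω → ℝ}

theorem IsCapacity.antitone_superlevel (hV : IsCapacity V) {f : Ω → ℝ} (hf : Measurable f) :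
    Antitone fun t => V {ω | t ≤ f ω} := fun _ _ hst =>
  hV.mono _ _ (measurableSet_le measurable_const hf) (measurableSet_le measurable_const hf)
    fun _ h => hst.trans h

theorem IsCapacity.superlevel_eq_zero (hV : IsCapacity V) {f : Ω → ℝ} {M t : ℝ}
    (hM : ∀ ω, |f ω| ≤ M) (ht : M < t) : V {ω | t ≤ f ω} = 0 := by
  convert hV.empty
  exact Set.eq_empty_of_forall_notMem fun ω hω =>
    absurd (ht.trans_le hω) (not_lt.2 ((le_abs_self _).trans (hM ω)))

theorem IsCapacity.superlevel_eq_one (hV : IsCapacity V) {f : Ω → ℝ} {M t : ℝ}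
    (hM : ∀ ω, |f ω| ≤ M) (ht : t < -M) : V {ω | t ≤ f ω} = 1 := by
  convert hV.univ
  exact Set.eq_univ_of_forall fun ω => ht.le.trans (abs_le.1 (hM ω)).1

theorem IsCapacity.choquet_ind (hV : IsCapacity V) (B : Set Ω) : choquet V (ind B) = V B := by
  have h₁ : ∀ t ∈ Set.Ioi (0 : ℝ),
      V {ω | t ≤ ind B ω} = (Set.Iic (1 : ℝ)).indicator (fun _ => V B) t := by
    intro t ht
    by_cases h1 : t ≤ 1
    · rw [Set.indicator_of_mem (by exact h1)]
      congr 1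
      ext ω
      by_cases hω : ω ∈ B
      · simp [ind, hω, h1]
      · simpa [ind, hω] using ht
    · rw [Set.indicator_of_notMem (by exact h1), ← hV.empty]
      congr 1
      refine Set.eq_empty_of_forall_notMem fun ω hω => h1 (hω.trans ?_)
      exact Set.indicator_le_self' (fun _ _ => zero_le_one) ω
  have h₂ : ∀ t ∈ Set.Iio (0 : ℝ), V {ω | t ≤ ind B ω} - 1 = 0 := by
    intro t ht
    rw [sub_eq_zero, ← hV.univ]
    congr 1
    exact Set.eq_univ_of_forall fun ω =>
      show t ≤ ind B ω from (le_of_lt ht).trans (Set.indicator_nonneg (fun _ _ => zero_le_one) ω)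
  rw [choquet, setIntegral_congr_fun measurableSet_Ioi h₁,
    setIntegral_congr_fun measurableSet_Iio h₂, setIntegral_indicator measurableSet_Iic]
  simp [Set.Ioi_inter_Iic]

theorem IsCapacity.choquet_zero (hV : IsCapacity V) : choquet V (fun _ => 0) = 0 := by
  have h : (fun _ : Ω => (0 : ℝ)) = ind ∅ := by simp [ind]
  rw [h, hV.choquet_ind, hV.empty]

/-- Positive homogeneity of the Choquet integral. -/
theorem IsCapacity.choquet_mul_const (hV : IsCapacity V) (f : Ω → ℝ) {c : ℝ} (hc : 0 ≤ c) :
    choquet V (fun ω => f ω * c) = choquet V f * c := by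
  rcases hc.eq_or_lt with rfl | hc
  · simpa using hV.choquet_zero
  -- Substitution t ↦ t/c, applied to each half-line, since both are stable under positive scaling.
  have key : ∀ (S : Set ℝ), MeasurableSet S → (∀ t, t * c⁻¹ ∈ S ↔ t ∈ S) → ∀ G : ℝ → ℝ,
      ∫ t in S, G (t * c⁻¹) = (∫ t in S, G t) * c := by
    intro S hS hmem G
    rw [← integral_indicator hS, ← integral_indicator hS]
    have : S.indicator (fun t => G (t * c⁻¹)) = fun t => S.indicator G (t * c⁻¹) := by
      ext t
      by_cases ht : t ∈ S
      · simp [ht, (hmem t).2 ht]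
      · simp [ht, mt (hmem t).1 ht]
    rw [this, Measure.integral_comp_mul_right, inv_inv, abs_of_pos hc, smul_eq_mul, mul_comm]
  have hset : ∀ t, {ω | t ≤ f ω * c} = {ω | t * c⁻¹ ≤ f ω} := fun t => by
    ext ω
    simp only [Set.mem_ofPred_eq]
    rw [← div_eq_mul_inv, div_le_iff₀ hc]
  simp only [choquet, hset, add_mul]
  rw [← key _ measurableSet_Ioi (fun t => by simp [hc]) fun t => V {ω | t ≤ f ω},
    ← key _ measurableSet_Iio (fun t => by simp [← div_eq_mul_inv, div_neg_iff, hc, hc.not_gt])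
      fun t => V {ω | t ≤ f ω} - 1]

/-- Modulo the V-null set Eᶜ, {h' > t} lies in the liminf of the superlevel sets, whose limsup lies
in {h' ≥ t}. Continuity of V from below and above controls these two sets, and continuity of the
level function at t closes the gap. -/
theorem IsUpperProbability.tendsto_superlevel (hV : IsUpperProbability V) {h : ℕ → Ω → ℝ}
    {h' : Ω → ℝ} (hm : ∀ n, Measurable (h n)) (hm' : Measurable h') {E : Set Ω}
    (hE : MeasurableSet E) (hEc : V Eᶜ = 0)
    (hlim : ∀ ω ∈ E, Tendsto (fun n => h n ω) atTop (𝓝 (h' ω))) {t : ℝ}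
    (ht : ContinuousAt (fun t => V {ω | t ≤ h' ω}) t) :
    Tendsto (fun n => V {ω | t ≤ h n ω}) atTop (𝓝 (V {ω | t ≤ h' ω})) := by
  have hmn : ∀ n, MeasurableSet {ω | t ≤ h n ω} := fun n => measurableSet_le measurable_const (hm n)
  have hm's : ∀ s, MeasurableSet {ω | s ≤ h' ω} := fun s => measurableSet_le measurable_const hm'
  let U : ℕ → Set Ω := fun n => ⋃ k, {ω | t ≤ h (n + k) ω}
  let L : ℕ → Set Ω := fun n => ⋂ k, {ω | t ≤ h (n + k) ω}
  have hUm : ∀ n, MeasurableSet (U n) := fun n => .iUnion fun k => hmn _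
  have hLm : ∀ n, MeasurableSet (L n) := fun n => .iInter fun k => hmn _
  have hU : Tendsto (fun n => V (U n)) atTop (𝓝 (V (⋂ n, U n))) := by
    refine hV.tendsto_iInter hUm fun m n hmn => Set.iUnion_subset fun i => ?_
    obtain ⟨k, rfl⟩ := Nat.exists_eq_add_of_le hmn
    rw [add_assoc]
    exact Set.subset_iUnion (fun i => {ω | t ≤ h (m + i) ω}) (k + i)
  have hL : Tendsto (fun n => V (L n)) atTop (𝓝 (V (⋃ n, L n))) := by
    refine hV.tendsto_iUnion hLm fun m n hmn => Set.subset_iInter fun i => ?_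
    obtain ⟨k, rfl⟩ := Nat.exists_eq_add_of_le hmn
    rw [add_assoc]
    exact Set.iInter_subset (fun i => {ω | t ≤ h (m + i) ω}) (k + i)
  have hUle : V (⋂ n, U n) ≤ V {ω | t ≤ h' ω} := by
    refine (hV.le_add_of_subset_union (.iInter hUm) (hm's t) hE.compl fun ω hω => ?_).trans
      (by rw [hEc, add_zero])
    by_cases hωE : ω ∈ E
    · refine .inl (ge_of_tendsto_of_frequently (hlim ω hωE) (frequently_atTop.2 fun n => ?_))
      obtain ⟨k, hk⟩ := Set.mem_iUnion.1 (Set.mem_iInter.1 hω n)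
      exact ⟨n + k, Nat.le_add_right n k, hk⟩
    · exact .inr hωE
  have hleL : V {ω | t ≤ h' ω} ≤ V (⋃ n, L n) := by
    -- For s > t, a point of E with s ≤ h' eventually satisfies t ≤ h n; then s decreases to t.
    refine le_of_tendsto (ht.tendsto.mono_left (nhdsWithin_le_nhds (s := Set.Ioi t))) ?_
    filter_upwards [self_mem_nhdsWithin] with s hs
    refine (hV.le_add_of_subset_union (hm's s) (.iUnion hLm) hE.compl fun ω hω => ?_).trans
      (by rw [hEc, add_zero])
    by_cases hωE : ω ∈ E
    · obtain ⟨n, hn⟩ := eventually_atTop.1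
        ((hlim ω hωE).eventually_const_le (lt_of_lt_of_le hs hω))
      exact .inl (Set.mem_iUnion.2 ⟨n, Set.mem_iInter.2 fun k => hn _ (Nat.le_add_right n k)⟩)
    · exact .inr hωE
  have hLU : ∀ n, V (L n) ≤ V {ω | t ≤ h n ω} := fun n =>
    hV.1.mono _ _ (hLm n) (hmn n) (Set.iInter_subset (fun k => {ω | t ≤ h (n + k) ω}) 0)
  have hUL : ∀ n, V {ω | t ≤ h n ω} ≤ V (U n) := fun n =>
    hV.1.mono _ _ (hmn n) (hUm n) (Set.subset_iUnion (fun k => {ω | t ≤ h (n + k) ω}) 0)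
  have hLleU : V (⋃ n, L n) ≤ V (⋂ n, U n) :=
    le_of_tendsto_of_tendsto' hL hU fun n => (hLU n).trans (hUL n)
  rw [le_antisymm hleL (hLleU.trans hUle)]
  refine tendsto_of_tendsto_of_tendsto_of_le_of_le hL ?_ hLU hUL
  rwa [le_antisymm hLleU (hUle.trans hleL)]

/-- Bounded convergence for the Choquet integral of an upper probability. -/
theorem IsUpperProbability.tendsto_choquet (hV : IsUpperProbability V) {h : ℕ → Ω → ℝ}
    {h' : Ω → ℝ} (hm : ∀ n, Measurable (h n)) (hm' : Measurable h') {M : ℝ}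
    (hM : ∀ n ω, |h n ω| ≤ M) {E : Set Ω} (hE : MeasurableSet E) (hEc : V Eᶜ = 0)
    (hlim : ∀ ω ∈ E, Tendsto (fun n => h n ω) atTop (𝓝 (h' ω))) :
    Tendsto (fun n => choquet V (h n)) atTop (𝓝 (choquet V h')) := by
  have hVc := hV.1
  have hae : ∀ᵐ t : ℝ, Tendsto (fun n => V {ω | t ≤ h n ω}) atTop (𝓝 (V {ω | t ≤ h' ω})) := by
    -- A monotone level function has only countably many discontinuities.
    filter_upwards [(hVc.antitone_superlevel hm').countable_not_continuousAt.ae_notMem volume]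
      with t ht
    exact hV.tendsto_superlevel hm hm' hE hEc hlim (not_not.1 ht)
  have hmeas : ∀ n, Measurable fun t => V {ω | t ≤ h n ω} := fun n =>
    (hVc.antitone_superlevel (hm n)).measurable
  have h01 : ∀ n t, V {ω | t ≤ h n ω} ∈ Set.Icc (0 : ℝ) 1 := fun n t =>
    ⟨hVc.nonneg (measurableSet_le measurable_const (hm n)),
      hVc.le_one (measurableSet_le measurable_const (hm n))⟩
  have hint : Integrable ((Set.Icc (-M) M).indicator fun _ => (1 : ℝ)) :=
    (integrable_indicator_iff measurableSet_Icc).2 (integrableOn_const (by simp))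
  refine Tendsto.add ?_ ?_
  · refine tendsto_integral_of_dominated_convergence ((Set.Icc (-M) M).indicator fun _ => (1 : ℝ))
      (fun n => (hmeas n).aestronglyMeasurable) hint.integrableOn (fun n => ?_)
      (ae_restrict_of_ae hae)
    refine (ae_restrict_mem measurableSet_Ioi).mono fun t ht => ?_
    have ht0 : 0 < t := ht
    by_cases htM : t ∈ Set.Icc (-M) M
    · rw [Set.indicator_of_mem htM, Real.norm_of_nonneg (h01 n t).1]
      exact (h01 n t).2
    · rw [Set.indicator_of_notMem htM, norm_le_zero_iff]
      refine hVc.superlevel_eq_zero (hM n) (not_le.1 fun hle => htM ⟨?_, hle⟩)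
      linarith
  · refine tendsto_integral_of_dominated_convergence ((Set.Icc (-M) M).indicator fun _ => (1 : ℝ))
      (fun n => ((hmeas n).sub_const 1).aestronglyMeasurable) hint.integrableOn (fun n => ?_)
      ((ae_restrict_of_ae hae).mono fun t ht => ht.sub_const 1)
    refine (ae_restrict_mem measurableSet_Iio).mono fun t ht => ?_
    have ht0 : t < 0 := ht
    by_cases htM : t ∈ Set.Icc (-M) M
    · rw [Set.indicator_of_mem htM, Real.norm_eq_abs, abs_le]
      constructor <;> linarith [(h01 n t).1, (h01 n t).2]
    · rw [Set.indicator_of_notMem htM, norm_le_zero_iff, sub_eq_zero]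
      refine hVc.superlevel_eq_one (hM n) (not_le.1 fun hle => htM ⟨hle, ?_⟩)
      linarith

end Choquet

/-! ### Correlation averages -/

section Correlation

variable {Ω : Type*}

theorem correlationAverage_eq_mul_birkhoffAverage (T : Ω → Ω) (f g : Ω → ℝ) (n : ℕ) (ω : Ω) :
    correlationAverage T f g n ω = f ω * birkhoffAverage ℝ T g n ω := by
  simp only [correlationAverage, birkhoffAverage, birkhoffSum, ← Finset.mul_sum, smul_eq_mul]
  ring

theorem abs_birkhoffAverage_le {T : Ω → Ω} {g : Ω → ℝ} {M : ℝ} (hg : ∀ ω, |g ω| ≤ M) (n : ℕ)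
    (ω : Ω) : |birkhoffAverage ℝ T g n ω| ≤ M := by
  rcases n.eq_zero_or_pos with rfl | hn
  · simpa using (abs_nonneg _).trans (hg ω)
  have hn' : (0 : ℝ) < n := by exact_mod_cast hn
  rw [birkhoffAverage, smul_eq_mul, abs_mul, abs_of_pos (inv_pos.2 hn'), inv_mul_le_iff₀ hn']
  refine (Finset.abs_sum_le_sum_abs _ _).trans ?_
  simpa using Finset.sum_le_card_nsmul (Finset.range n) (fun k => |g (T^[k] ω)|) M
    fun k _ => hg _

theorem isBoundedMeasurable_ind [MeasurableSpace Ω] {B : Set Ω} (hB : MeasurableSet B) :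
    IsBoundedMeasurable (ind B) := by
  refine ⟨measurable_const.indicator hB, 1, fun ω => ?_⟩
  by_cases h : ω ∈ B <;> simp [ind, h]

theorem ind_comp_iterate {T : Ω → Ω} {A : Set Ω} (hA : T ⁻¹' A = A) (i : ℕ) (ω : Ω) :
    ind A (T^[i] ω) = ind A ω := by
  have h : T^[i] ω ∈ A ↔ ω ∈ A := by
    rw [← Set.mem_preimage, show T^[i] ⁻¹' A = A from Function.IsFixedPt.preimage_iterate hA i]
  by_cases hω : ω ∈ A
  · simp [ind, hω, h.2 hω]
  · simp [ind, hω, mt h.1 hω]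

theorem correlationAverage_ind_self {T : Ω → Ω} {A : Set Ω} (hA : T ⁻¹' A = A) {n : ℕ}
    (hn : n ≠ 0) : correlationAverage T (ind A) (ind A) n = ind A := by
  ext ω
  simp only [correlationAverage, ind_comp_iterate hA]
  by_cases hω : ω ∈ A <;> simp [ind, hω, hn]

theorem correlationAverage_ind_compl {T : Ω → Ω} {A : Set Ω} (hA : T ⁻¹' A = A) (n : ℕ) :
    correlationAverage T (ind A) (ind Aᶜ) n = fun _ => 0 := by
  have hAc : T ⁻¹' Aᶜ = Aᶜ := by rw [Set.preimage_compl, hA]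
  ext ω
  simp only [correlationAverage, ind_comp_iterate hAc]
  by_cases hω : ω ∈ A <;> simp [ind, hω]

/-- For an invariant upper probability `V` and an ergodic probability `Q` such that invariant
`Q`-null sets are `V`-null, the Choquet integrals of the correlation averages converge. -/
theorem IsUpperProbability.tendsto_choquet_correlationAverage [MeasurableSpace Ω]
    {V : Set Ω → ℝ} (hV : IsUpperProbability V) {T : Ω → Ω} {Q : ProbabilityMeasure Ω}
    (hQ : Ergodic T (Q : Measure Ω))
    (hnull : ∀ A : Set Ω, MeasurableSet A → T ⁻¹' A = A → (Q : Measure Ω).real A = 0 → V A = 0)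
    {f g : Ω → ℝ} (hf : IsBoundedMeasurable f) (hg : IsBoundedMeasurable g) (hg0 : ∀ ω, 0 ≤ g ω) :
    Tendsto (fun n : ℕ => choquet V (correlationAverage T f g n)) atTop
      (𝓝 (choquet V f * ∫ ω, g ω ∂(Q : Measure Ω))) := by
  obtain ⟨hfm, Mf, hMf⟩ := hf
  obtain ⟨hgm, Mg, hMg⟩ := hg
  have hgi : Integrable g (Q : Measure Ω) :=
    .of_bound hgm.aestronglyMeasurable Mg (Eventually.of_forall hMg)
  obtain ⟨E, hE, hTE, hEc, hlim⟩ := exists_invariant_tendsto_birkhoffAverage hQ hgm hgi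
  rw [← hV.1.choquet_mul_const f (integral_nonneg hg0)]
  refine hV.tendsto_choquet (M := Mf * Mg) (E := E) (fun n => ?_) (hfm.mul_const _)
    (fun n ω => ?_) hE
    (hnull _ hE.compl (by rw [Set.preimage_compl, hTE]) (by rw [Measure.real, hEc]; rfl))
    fun ω hω => ?_
  · have := hQ.measurable
    exact (Finset.measurable_fun_sum _ fun i _ => hfm.mul (hgm.comp (this.iterate i))).const_mul _
  · rw [correlationAverage_eq_mul_birkhoffAverage, abs_mul]
    exact mul_le_mul (hMf ω) (abs_birkhoffAverage_le hMg n ω) (abs_nonneg _)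
      ((abs_nonneg _).trans (hMf ω))
  · simp only [correlationAverage_eq_mul_birkhoffAverage]
    exact (hlim ω hω).const_mul (f ω)

end Correlation

/-! ### Ergodicity of V and of core elements -/

section Ergodicity

variable {Ω : Type*} [MeasurableSpace Ω] {V : Set Ω → ℝ}

/-- Domination on both A and Aᶜ traps Q(A): V(A) = 0 forces Q(A) = 0, while V(Aᶜ) = 0 forces Q(A) =
1. -/
theorem IsErgodic.eq_of_mem_core {T : Ω → Ω} (hV : IsUpperProbability V) (he : IsErgodic T V)
    {Q : ProbabilityMeasure Ω} (hQ : (Q : Measure Ω).real ∈ core V) {A : Set Ω}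
    (hA : MeasurableSet A) (hTA : T ⁻¹' A = A) : V A = (Q : Measure Ω).real A := by
  have h1 := hQ.2.2 A hA
  have h2 := hQ.2.2 Aᶜ hA.compl
  rw [probReal_compl_eq_one_sub hA] at h2
  have h3 : (0 : ℝ) ≤ (Q : Measure Ω).real A := measureReal_nonneg
  rcases (he A hA hTA).2 with h | h
  · linarith
  · linarith [hV.1.le_one hA]

theorem IsErgodic.ergodic_of_mem_core {T : Ω → Ω} (he : IsErgodic T V)
    {Q : ProbabilityMeasure Ω} (hQ : (Q : Measure Ω).real ∈ core V)
    (hT : MeasurePreserving T (Q : Measure Ω) (Q : Measure Ω)) : Ergodic T (Q : Measure Ω) := by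
  refine ⟨hT, ⟨fun A hA hTA => ?_⟩⟩
  rw [eventuallyConst_set']
  have key : ∀ B : Set Ω, MeasurableSet B → V B = 0 → (Q : Measure Ω) B = 0 := fun B hB h =>
    (measureReal_eq_zero_iff).1 (le_antisymm (h ▸ hQ.2.2 B hB) measureReal_nonneg)
  rcases (he A hA hTA).2 with h | h
  · exact .inl (ae_eq_empty.2 (key A hA h))
  · exact .inr (ae_eq_univ.2 (key _ hA.compl h))

/-- The zero-one clause comes for free: by subadditivity, V(Aᶜ) = 0 forces V(A) = 1. -/
theorem isErgodic_of_null_or_null {T : Ω → Ω} (hV : IsUpperProbability V)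
    (h : ∀ A : Set Ω, MeasurableSet A → T ⁻¹' A = A → V A = 0 ∨ V Aᶜ = 0) : IsErgodic T V := by
  refine fun A hA hTA => ⟨(h A hA hTA).imp_right fun hAc => ?_, h A hA hTA⟩
  have := hV.union_le hA hA.compl
  rw [Set.union_compl_self, hV.1.univ, hAc] at this
  linarith [hV.1.le_one hA]

end Ergodicity

end UpperProb

end

/-! ### The cycle of implications -/

theorem theorem4p3 {Ω : Type*} [MeasurableSpace Ω] (T : Ω → Ω) (hT : Measurable T)
    (V : Set Ω → ℝ) (hV : UpperProb.IsUpperProbability V) (hinv : UpperProb.IsInvariant T V) :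
    List.TFAE [
      -- (i)
      UpperProb.IsErgodic T V,
      -- (ii)
      ∃ Q : ProbabilityMeasure Ω,
        (Q : Measure Ω).real ∈ UpperProb.core V ∧ Ergodic T (Q : Measure Ω) ∧
        (∀ A : Set Ω, MeasurableSet A → T ⁻¹' A = A →
          V A = (Q : Measure Ω).real A) ∧
        ∀ f g : Ω → ℝ, UpperProb.IsBoundedMeasurable f → UpperProb.IsBoundedMeasurable g →
          (∀ ω, 0 ≤ g ω) →
          Tendsto (fun n : ℕ => UpperProb.choquet V (UpperProb.correlationAverage T f g n)) atTop
            (𝓝 (UpperProb.choquet V f * ∫ ω, g ω ∂(Q : Measure Ω))),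
      -- (iii)
      ∃ Q : ProbabilityMeasure Ω,
        (Q : Measure Ω).real ∈ UpperProb.core V ∧
        MeasurePreserving T (Q : Measure Ω) (Q : Measure Ω) ∧
        ∀ B C : Set Ω, MeasurableSet B → MeasurableSet C →
          Tendsto (fun n : ℕ => UpperProb.choquet V
              (UpperProb.correlationAverage T (UpperProb.ind B) (UpperProb.ind C) n)) atTop
            (𝓝 (V B * (Q : Measure Ω).real C)),
      -- (iv)
      ∃ Q : ProbabilityMeasure Ω,
        (∀ A : Set Ω, MeasurableSet A → T ⁻¹' A = A →
          (Q : Measure Ω).real A = 0 → V A = 0) ∧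
        ∀ B C : Set Ω, MeasurableSet B → MeasurableSet C →
          V B * (Q : Measure Ω).real C ≤
            liminf (fun n : ℕ => UpperProb.choquet V
              (UpperProb.correlationAverage T (UpperProb.ind B) (UpperProb.ind C) n)) atTop] := by
  tfae_have 1 → 2 := by
    intro he
    obtain ⟨Q, hQ, hTQ⟩ := hV.exists_invariant_mem_core hT hinv
    have hQe := he.ergodic_of_mem_core hQ hTQ
    have hVQ : ∀ A : Set Ω, MeasurableSet A → T ⁻¹' A = A → V A = (Q : Measure Ω).real A :=
      fun A hA hTA => he.eq_of_mem_core hV hQ hA hTA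
    exact ⟨Q, hQ, hQe, hVQ, fun f g hf hg hg0 => hV.tendsto_choquet_correlationAverage hQe
      (fun A hA hTA h => (hVQ A hA hTA).trans h) hf hg hg0⟩
  tfae_have 2 → 3 := by
    rintro ⟨Q, hQ, hQe, -, hlim⟩
    refine ⟨Q, hQ, hQe.toMeasurePreserving, fun B C hB hC => ?_⟩
    have := hlim _ _ (UpperProb.isBoundedMeasurable_ind hB) (UpperProb.isBoundedMeasurable_ind hC)
      (Set.indicator_nonneg fun _ _ => zero_le_one)
    have hint : ∫ ω, UpperProb.ind C ω ∂(Q : Measure Ω) = (Q : Measure Ω).real C :=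
      integral_indicator_one hC
    rwa [hV.1.choquet_ind, hint] at this
  tfae_have 3 → 4 := by
    rintro ⟨Q, -, -, hlim⟩
    refine ⟨Q, fun A hA hTA hQA => ?_, fun B C hB hC => (hlim B C hB hC).liminf_eq.ge⟩
    have h := hlim A A hA hA
    rw [hQA, mul_zero] at h
    -- The integrals equal V(A) for every n ≠ 0 (the average at n = 0 is 0 by convention), yet tend
    -- to V(A) Q(A) = 0.
    refine tendsto_nhds_unique (tendsto_const_nhds.congr' ?_) h
    filter_upwards [eventually_ne_atTop 0] with n hn
    rw [UpperProb.correlationAverage_ind_self hTA hn, hV.1.choquet_ind]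
  tfae_have 4 → 1 := by
    rintro ⟨Q, hnull, hlim⟩
    refine UpperProb.isErgodic_of_null_or_null hV fun A hA hTA => ?_
    have h := hlim A Aᶜ hA hA.compl
    simp only [UpperProb.correlationAverage_ind_compl hTA, hV.1.choquet_zero,
      liminf_const] at h
    -- The liminf is 0, so V(A) Q(Aᶜ) = 0; if the second factor vanishes, the null-set hypothesis
    -- gives V(Aᶜ) = 0.
    refine (mul_eq_zero.1 (le_antisymm h
      (mul_nonneg (hV.1.nonneg hA) measureReal_nonneg))).imp_right fun h0 => ?_
    exact hnull _ hA.compl (by rw [Set.preimage_compl, hTA]) h0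
  tfae_finish
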